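/- Let $\Gamma$ be a countable group acting ergodically by measure preserving transformations on a probability space $(X,\mu)$ which is separable (that is, $L^2(X,\mu)$ is separable; e.g. a standard probability space). The action is called compact if the unitary representation $\pi(\gamma)f=f\circ\gamma^{-1}$ of $\Gamma$ on $L^2(X,\mu)$ is a (Hilbert space) direct sum of finite dimensional representations. Let $\Gamma$ act on $X\times X$ diagonally, $\gamma(x,y)=(\gamma x,\gamma y)$. Then the action $\Gamma\curvearrowright (X,\mu)$ is compact if and only if there exists a sequence $(\eta_n)_{n}$ in $L^1(X\times X,\mu\times\mu)$ of $\Gamma$-invariant, positive (i.e. $\eta_n\ge 0$ a.e.) vectors with $\|\eta_n\|_1=1$ for all $n$ and $$\lim_{n\to\infty}\|1_{A\times (X\setminus A)}\,\eta_n\|_1=0\quad\text{for every measurable set } A\subset X.$$ In particular, every compact action (with $\Gamma$ and $(X,\mu)$ as above) is weakly compact, that is, there exists a sequence $(\eta_n)_{n}$ in $L^1(X\times X,\mu\times\mu)$ with $\eta_n\ge 0$ and $\|\eta_n\|_1=1$ for all $n$ such that (i) $\lim_{n\to\infty}\|1_{A\times (X\setminus A)}\,\eta_n\|_1=0$ for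 every measurable set $A\subset X$; (ii) $\lim_{n\to\infty}\|\eta_n-\eta_n\circ(\gamma\times\gamma)\|_1=0$ for every $\gamma\in\Gamma$; (iii) for every $n$, $\int_X\eta_n(x,y)\,d\mu(x)=1$ for a.e. $y$ and $\int_X\eta_n(x,y)\,d\mu(y)=1$ for a.e. $x$. -/

import Mathlib

open MeasureTheory Filter Topology

noncomputable section

/-- The unitary representation `π : Γ → U(L²(X, μ))` induced by a measure preserving action
`Γ ↷ (X, μ)`, that is `π(γ) f = f ∘ γ⁻¹`. -/
def koopmanRep (Γ : Type*) {X : Type*} [Group Γ] [MulAction Γ X] [MeasurableSpace X]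
    [MeasurableConstSMul Γ X] (μ : Measure X) [SMulInvariantMeasure Γ X μ] :
    Γ →* (Lp ℂ 2 μ ≃ₗᵢ[ℂ] Lp ℂ 2 μ) where
  toFun γ :=
    { toFun := Lp.compMeasurePreservingₗ ℂ (fun x : X => γ⁻¹ • x) (measurePreserving_smul γ⁻¹ μ)
      invFun := Lp.compMeasurePreservingₗ ℂ (fun x : X => γ • x) (measurePreserving_smul γ μ)
      map_add' := map_add _
      map_smul' := map_smul _
      left_inv := fun f => by
        have h := smul_smul (DomMulAct.mk γ) (DomMulAct.mk γ⁻¹) f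
        rw [← DomMulAct.mk_mul, inv_mul_cancel, DomMulAct.mk_one, one_smul] at h
        exact h
      right_inv := fun f => by
        have h := smul_smul (DomMulAct.mk γ⁻¹) (DomMulAct.mk γ) f
        rw [← DomMulAct.mk_mul, mul_inv_cancel, DomMulAct.mk_one, one_smul] at h
        exact h
      norm_map' := fun f => Lp.norm_compMeasurePreserving f (measurePreserving_smul γ⁻¹ μ) }
  map_one' := by
    ext1 f
    have h := one_smul Γᵈᵐᵃ f
    rw [← DomMulAct.mk_one, ← inv_one] at h
    exact h
  map_mul' γ δ := by
    ext1 f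
    have h := mul_smul (DomMulAct.mk γ⁻¹) (DomMulAct.mk δ⁻¹) f
    rw [← DomMulAct.mk_mul, ← mul_inv_rev] at h
    exact h

theorem koopmanRep_ae_eq {Γ X : Type*} [Group Γ] [MulAction Γ X] [MeasurableSpace X]
    [MeasurableConstSMul Γ X] (μ : Measure X) [SMulInvariantMeasure Γ X μ]
    (γ : Γ) (f : Lp ℂ 2 μ) :
    koopmanRep Γ μ γ f =ᵐ[μ] fun x => f (γ⁻¹ • x) :=
  Lp.coeFn_compMeasurePreserving f (measurePreserving_smul γ⁻¹ μ)

/-- A (measure preserving, ergodic) action is compact if the induced unitary representation on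
`L²(X, μ)` decomposes as a Hilbert space direct sum of finite dimensional representations: `L²` is
the orthogonal Hilbert sum of a family `S` of finite dimensional invariant subspaces. -/
def IsCompactAction (Γ : Type*) {X : Type*} [Group Γ] [MulAction Γ X] [MeasurableSpace X]
    [MeasurableConstSMul Γ X] (μ : Measure X) [SMulInvariantMeasure Γ X μ] : Prop :=
  ∃ S : Set (Submodule ℂ (Lp ℂ 2 μ)),
    (∀ V ∈ S, FiniteDimensional ℂ V ∧ ∀ γ : Γ, ∀ f ∈ V, koopmanRep Γ μ γ f ∈ V) ∧
    IsHilbertSum ℂ (fun V : S => (V : Submodule ℂ (Lp ℂ 2 μ)))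
      (fun V : S => (V : Submodule ℂ (Lp ℂ 2 μ)).subtypeₗᵢ)

/-- A (measure preserving, ergodic) action is weakly compact if there are positive unit vectors
`η n ∈ L¹(X × X, μ × μ)` with `‖1_{A × (X ∖ A)} η n‖₁ → 0` for every measurable set `A`, with
`‖η n - η n ∘ (γ × γ)‖₁ → 0` for every `γ ∈ Γ`, and with both marginals equal to `1`. -/
def IsWeaklyCompactAction (Γ : Type*) {X : Type*} [Group Γ] [MulAction Γ X] [MeasurableSpace X]
    (μ : Measure X) : Prop :=
  ∃ η : ℕ → Lp ℝ 1 (μ.prod μ),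
    (∀ n, 0 ≤ η n) ∧ (∀ n, ‖η n‖ = 1) ∧
    (∀ A : Set X, MeasurableSet A →
      Tendsto (fun n => eLpNorm ((A ×ˢ Aᶜ).indicator (η n)) 1 (μ.prod μ)) atTop (𝓝 0)) ∧
    (∀ γ : Γ,
      Tendsto (fun n => eLpNorm (fun p : X × X => η n p - η n (γ • p.1, γ • p.2)) 1 (μ.prod μ))
        atTop (𝓝 0)) ∧
    (∀ n, (∀ᵐ y ∂μ, ∫ x, η n (x, y) ∂μ = 1) ∧ (∀ᵐ x ∂μ, ∫ y, η n (x, y) ∂μ = 1))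

end

/-! Kernels to compactness. Let `f` be orthogonal to every finite dimensional subrepresentation.
Truncating `|η n|` at a height that keeps at least half of the mass gives a bounded invariant kernel
`k`, hence a Hilbert-Schmidt operator commuting with the representation. The nonzero eigenspaces of
its positive square are finite dimensional subrepresentations, so the operator kills `f`
(`hilbertSchmidt_eq_zero_of_orthogonal`). Thus `1_A(x) conj (f y) k(x,y)` integrates to zero, while
by ergodicity `k` has constant marginal `c`, so `1_A(y) conj (f y) k(x,y)` integrates to `c` times
the conjugate of `∫_A f`. The two integrands differ only on pairs separated by `A`, which carry
little mass. Hence `∫_A f = 0` for all `A`, so `f = 0`, and Zorn's lemma turns this into a Hilbert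
sum (`exists_isHilbertSum_of_isFiniteDimInvariant`).

Compactness to kernels. An orthonormal basis of a finite dimensional subrepresentation `V` maps `X`
to a Euclidean space, and the pulled back distance is invariant because the group changes the basis
by a unitary matrix. The normalised indicator of the pairs at distance less than `ε` is an invariant
density (`exists_invariant_density`), with both marginals `1` by ergodicity. As `V` grows along a
sequence with dense union and `ε` tends to `0`, each `1_A` is approximated by functions nearly
constant along the density, and the marginals control the error (`eLpNorm_indicator_prod_compl_le`).
-/

open scoped InnerProductSpace ComplexConjugate ENNReal

/-! ### Finite dimensional subrepresentations and Hilbert sums -/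

section UnitaryRepresentation

variable {Γ H : Type*} [Group Γ] [NormedAddCommGroup H] [InnerProductSpace ℂ H]

/-- A finite dimensional subrepresentation of a unitary representation. -/
def IsFiniteDimInvariant (ρ : Γ →* (H ≃ₗᵢ[ℂ] H)) (V : Submodule ℂ H) : Prop :=
  FiniteDimensional ℂ V ∧ ∀ γ : Γ, ∀ f ∈ V, ρ γ f ∈ V

variable {ρ : Γ →* (H ≃ₗᵢ[ℂ] H)}

theorem isFiniteDimInvariant_bot : IsFiniteDimInvariant ρ ⊥ :=
  ⟨inferInstance, fun γ f hf => by simp_all⟩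

theorem IsFiniteDimInvariant.sup {V W : Submodule ℂ H} (hV : IsFiniteDimInvariant ρ V)
    (hW : IsFiniteDimInvariant ρ W) : IsFiniteDimInvariant ρ (V ⊔ W) := by
  have := hV.1
  have := hW.1
  refine ⟨inferInstance, fun γ f hf => ?_⟩
  obtain ⟨v, hv, w, hw, rfl⟩ := Submodule.mem_sup.1 hf
  rw [map_add]
  exact Submodule.add_mem_sup (hV.2 γ v hv) (hW.2 γ w hw)

theorem map_inv_apply_self (γ : Γ) (f : H) : ρ γ (ρ γ⁻¹ f) = f := by
  change (ρ γ * ρ γ⁻¹) f = f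
  rw [← map_mul, mul_inv_cancel, map_one]
  rfl

theorem map_apply_inv_self (γ : Γ) (f : H) : ρ γ⁻¹ (ρ γ f) = f := by
  change (ρ γ⁻¹ * ρ γ) f = f
  rw [← map_mul, inv_mul_cancel, map_one]
  rfl

theorem inner_map_left (γ : Γ) (f g : H) : ⟪ρ γ f, g⟫_ℂ = ⟪f, ρ γ⁻¹ g⟫_ℂ := by
  rw [← (ρ γ).inner_map_map f, map_inv_apply_self]

theorem starProjection_comm_of_invariant {C : Submodule ℂ H} [C.HasOrthogonalProjection]
    (hC : ∀ γ, ∀ f ∈ C, ρ γ f ∈ C) (γ : Γ) (f : H) :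
    C.starProjection (ρ γ f) = ρ γ (C.starProjection f) := by
  refine Submodule.eq_starProjection_of_mem_of_inner_eq_zero
    (hC γ _ (Submodule.starProjection_apply_mem C f)) fun w hw => ?_
  rw [← map_sub, inner_map_left]
  exact Submodule.starProjection_inner_eq_zero f _ (hC _ w hw)

variable [CompleteSpace H]

/-- A compact symmetric operator commuting with the representation vanishes on the orthogonal
complement of all finite dimensional subrepresentations. -/
theorem apply_eq_zero_of_orthogonal_isFiniteDimInvariant {T : H →L[ℂ] H}
    (hT : IsCompactOperator T) (hsymm : T.IsSymmetric)
    (hcomm : ∀ γ f, T (ρ γ f) = ρ γ (T f)) {f : H}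
    (hf : ∀ V, IsFiniteDimInvariant ρ V → f ∈ Vᗮ) : T f = 0 := by
  have hbot := ContinuousLinearMap.orthogonalComplement_iSup_eigenspaces_eq_bot hT hsymm
  -- The eigenspaces span a dense subspace, so it suffices to test `T f` against eigenvectors;
  -- moving `T` across leaves a factor `conj z`, which disposes of `z = 0`.
  rw [← Submodule.mem_bot ℂ, ← hbot, ← Submodule.iInf_orthogonal, Submodule.mem_iInf]
  intro z v hv
  have hv' : T v = z • v := Module.End.mem_eigenspace_iff.1 hv
  have hsym : ⟪v, T f⟫_ℂ = ⟪T v, f⟫_ℂ := (hsymm v f).symm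
  rw [hsym, hv', inner_smul_left]
  rcases eq_or_ne z 0 with rfl | hz
  · simp
  · have hV : IsFiniteDimInvariant ρ (Module.End.eigenspace T.toLinearMap z) := by
      refine ⟨ContinuousLinearMap.finite_dimensional_eigenspace hT z hz, fun γ w hw => ?_⟩
      have hw' : T w = z • w := Module.End.mem_eigenspace_iff.1 hw
      refine Module.End.mem_eigenspace_iff.2 ?_
      change T (ρ γ w) = z • ρ γ w
      rw [hcomm, hw', map_smul]
    rw [hf _ hV v hv, mul_zero]

/-- If the finite dimensional subrepresentations have dense span, the representation is an
orthogonal Hilbert sum of finite dimensional subrepresentations. -/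
theorem exists_isHilbertSum_of_isFiniteDimInvariant
    (h : ∀ f : H, (∀ V, IsFiniteDimInvariant ρ V → f ∈ Vᗮ) → f = 0) :
    ∃ S : Set (Submodule ℂ H), (∀ V ∈ S, IsFiniteDimInvariant ρ V) ∧
      IsHilbertSum ℂ (fun V : S => (V : Submodule ℂ H))
        (fun V : S => (V : Submodule ℂ H).subtypeₗᵢ) := by
  obtain ⟨S, hS⟩ := zorn_subset
    {S : Set (Submodule ℂ H) | (∀ V ∈ S, IsFiniteDimInvariant ρ V ∧ V ≠ ⊥) ∧
      S.Pairwise (· ⟂ ·)} (by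
    intro c hc hchain
    refine ⟨⋃₀ c, ⟨?_, ?_⟩, fun s hs => Set.subset_sUnion_of_mem hs⟩
    · rintro V ⟨s, hs, hV⟩
      exact (hc hs).1 V hV
    · exact (Set.pairwise_sUnion hchain.directedOn).2 fun s hs => (hc hs).2)
  refine ⟨S, fun V hV => (hS.prop.1 V hV).1, ?_⟩
  have hcomp : ∀ V : S, CompleteSpace (V : Submodule ℂ H) := fun V =>
    have := (hS.prop.1 V V.2).1.1
    FiniteDimensional.complete ℂ _
  refine IsHilbertSum.mkInternal _ (OrthogonalFamily.of_pairwise fun V W hVW =>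
    hS.prop.2 V.2 W.2 fun h => hVW (Subtype.ext h)) ?_
  rw [top_le_iff, Submodule.topologicalClosure_eq_top_iff]
  set C : Submodule ℂ H := (⨆ V : S, (V : Submodule ℂ H))ᗮ with hCdef
  have hCmem : ∀ f, f ∈ C ↔ ∀ V ∈ S, f ∈ Vᗮ := by
    intro f
    rw [hCdef, ← Submodule.iInf_orthogonal, Submodule.mem_iInf]
    simp
  have hC : ∀ γ, ∀ f ∈ C, ρ γ f ∈ C := by
    intro γ f hf
    rw [hCmem] at hf ⊢
    intro V hV v hv
    rw [← inner_conj_symm, inner_map_left, inner_conj_symm]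
    exact hf V hV _ ((hS.prop.1 V hV).1.2 _ v hv)
  rw [Submodule.eq_bot_iff]
  intro f hf
  refine h f fun V hV => ?_
  have hVfin := hV.1
  -- The projection of `V` to `C` is again a subrepresentation, orthogonal to all of `S`; were it
  -- nonzero, maximality would put it in `S`, making it orthogonal to itself.
  set W := V.map C.starProjection.toLinearMap with hW
  have hWinv : IsFiniteDimInvariant ρ W := by
    refine ⟨inferInstance, ?_⟩
    rintro γ _ ⟨v, hv, rfl⟩
    exact ⟨ρ γ v, hV.2 γ v hv, starProjection_comm_of_invariant hC γ v⟩
  have hWC : W ≤ C := by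
    rintro _ ⟨v, -, rfl⟩
    exact Submodule.starProjection_apply_mem C v
  have hWbot : W = ⊥ := by
    by_contra hne
    have hWS : ∀ V ∈ S, W ⟂ V := fun V hV w hw => (hCmem w).1 (hWC hw) V hV
    have hins : insert W S ⊆ S := hS.le_of_ge (y := insert W S) ⟨by
      rintro V (rfl | hV)
      · exact ⟨hWinv, hne⟩
      · exact hS.prop.1 V hV, by
      refine hS.prop.2.insert fun V hV _ => ⟨hWS V hV, (hWS V hV).symm⟩⟩ (Set.subset_insert W S)
    have : W ⟂ W := hWS W (hins (Set.mem_insert W S))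
    exact hne (Submodule.isOrtho_self.1 this)
  intro v hv
  have hv0 : C.starProjection v = 0 := by
    have : C.starProjection v ∈ W := ⟨v, hv, rfl⟩
    rwa [hWbot, Submodule.mem_bot] at this
  have := Submodule.starProjection_inner_eq_zero (K := C) v f hf
  rwa [hv0, sub_zero] at this

end UnitaryRepresentation

/-! ### Riesz adjoint of a bounded bilinear map -/

section BilinearAdjoint

variable {E F G : Type*} [NormedAddCommGroup E] [InnerProductSpace ℂ E] [CompleteSpace E]
  [NormedAddCommGroup F] [InnerProductSpace ℂ F] [NormedAddCommGroup G] [InnerProductSpace ℂ G]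
  [CompleteSpace G]

/-- The adjoint of a bounded bilinear map in its first argument: `k` and `f` are mapped to the
Riesz representative of `e ↦ ⟪Φ e f, k⟫`. -/
noncomputable def bilinAdjoint (Φ : E →L[ℂ] F →L[ℂ] G) : G →L[ℂ] F →L⋆[ℂ] E :=
  ((ContinuousLinearMap.adjoint (𝕜 := ℂ) (E := E)
    (F := G)).toContinuousLinearEquiv.toContinuousLinearMap.comp Φ.flip).flip

theorem inner_bilinAdjoint (Φ : E →L[ℂ] F →L[ℂ] G) (k : G) (e : E) (f : F) :
    ⟪e, bilinAdjoint Φ k f⟫_ℂ = ⟪Φ e f, k⟫_ℂ :=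
  ContinuousLinearMap.adjoint_inner_right (Φ.flip f) e k

end BilinearAdjoint

/-! ### Tensor products and Hilbert-Schmidt operators -/

section HilbertSchmidt

variable {X : Type*} [MeasurableSpace X] {μ : Measure X} [IsFiniteMeasure μ]

theorem eLpNorm_two_prod_mul {f g : X → ℂ} (hf : AEStronglyMeasurable f μ)
    (hg : AEStronglyMeasurable g μ) :
    eLpNorm (fun p : X × X => f p.1 * g p.2) 2 (μ.prod μ) = eLpNorm f 2 μ * eLpNorm g 2 μ := by
  simp only [eLpNorm_eq_lintegral_rpow_enorm_toReal two_ne_zero ENNReal.ofNat_ne_top]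
  rw [← ENNReal.mul_rpow_of_nonneg _ _ (by positivity),
    ← lintegral_prod_mul (hf.enorm.pow_const _) (hg.enorm.pow_const _)]
  simp [enorm_mul, mul_pow]

theorem MeasureTheory.MemLp.two_prod_mul {f g : X → ℂ} (hf : MemLp f 2 μ) (hg : MemLp g 2 μ) :
    MemLp (fun p : X × X => f p.1 * g p.2) 2 (μ.prod μ) :=
  ⟨hf.1.comp_fst.mul hg.1.comp_snd, by
    rw [eLpNorm_two_prod_mul hf.1 hg.1]; exact ENNReal.mul_lt_top hf.2 hg.2⟩

variable (μ) in
/-- The tensor product `(f ⊗ g) (x, y) = f x * g y` of square integrable functions. -/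
noncomputable def lpTensor : Lp ℂ 2 μ →L[ℂ] Lp ℂ 2 μ →L[ℂ] Lp ℂ 2 (μ.prod μ) :=
  LinearMap.mkContinuous₂
    (LinearMap.mk₂ ℂ (fun f g => ((Lp.memLp f).two_prod_mul (Lp.memLp g)).toLp _)
      (fun f₁ f₂ g => by
        rw [← MemLp.toLp_add, MemLp.toLp_eq_toLp_iff]
        filter_upwards [Measure.quasiMeasurePreserving_fst.ae (Lp.coeFn_add f₁ f₂)] with p hp
        simp only [hp, Pi.add_apply, add_mul])
      (fun c f g => by
        rw [← MemLp.toLp_const_smul, MemLp.toLp_eq_toLp_iff]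
        filter_upwards [Measure.quasiMeasurePreserving_fst.ae (Lp.coeFn_smul c f)] with p hp
        simp [hp, mul_assoc])
      (fun f g₁ g₂ => by
        rw [← MemLp.toLp_add, MemLp.toLp_eq_toLp_iff]
        filter_upwards [Measure.quasiMeasurePreserving_snd.ae (Lp.coeFn_add g₁ g₂)] with p hp
        simp only [hp, Pi.add_apply, mul_add])
      (fun c f g => by
        rw [← MemLp.toLp_const_smul, MemLp.toLp_eq_toLp_iff]
        filter_upwards [Measure.quasiMeasurePreserving_snd.ae (Lp.coeFn_smul c g)] with p hp
        simp [hp, mul_left_comm]))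
    1 (fun f g => by
      rw [LinearMap.mk₂_apply, Lp.norm_toLp, eLpNorm_two_prod_mul (Lp.aestronglyMeasurable f)
        (Lp.aestronglyMeasurable g), ENNReal.toReal_mul, one_mul, Lp.norm_def, Lp.norm_def])

theorem lpTensor_ae_eq (f g : Lp ℂ 2 μ) :
    lpTensor μ f g =ᵐ[μ.prod μ] fun p => f p.1 * g p.2 :=
  MemLp.coeFn_toLp ((Lp.memLp f).two_prod_mul (Lp.memLp g))

theorem inner_lpTensor (f g : Lp ℂ 2 μ) (k : Lp ℂ 2 (μ.prod μ)) :
    ⟪lpTensor μ f g, k⟫_ℂ = ∫ p, conj (f p.1) * conj (g p.2) * k p ∂(μ.prod μ) := by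
  rw [L2.inner_def]
  refine integral_congr_ae ?_
  filter_upwards [lpTensor_ae_eq f g] with p hp
  rw [hp, RCLike.inner_apply, map_mul, mul_comm]

theorem inner_lpTensor_lpTensor (f g f' g' : Lp ℂ 2 μ) :
    ⟪lpTensor μ f g, lpTensor μ f' g'⟫_ℂ = ⟪f, f'⟫_ℂ * ⟪g, g'⟫_ℂ := by
  rw [inner_lpTensor, L2.inner_def, L2.inner_def, ← integral_prod_mul]
  refine integral_congr_ae ?_
  filter_upwards [lpTensor_ae_eq f' g'] with p hp
  rw [hp, RCLike.inner_apply, RCLike.inner_apply]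
  ring

/-- Elementary tensors span a dense subspace. -/
theorem eq_zero_of_inner_lpTensor_eq_zero {k : Lp ℂ 2 (μ.prod μ)}
    (hk : ∀ f g : Lp ℂ 2 μ, ⟪lpTensor μ f g, k⟫_ℂ = 0) : k = 0 := by
  have hint : Integrable k (μ.prod μ) := (Lp.memLp k).integrable one_le_two
  have hrect : ∀ A B : Set X, MeasurableSet A → MeasurableSet B →
      ∫ p in A ×ˢ B, k p ∂(μ.prod μ) = 0 := by
    intro A B hA hB
    rw [← hk (indicatorConstLp 2 hA (measure_ne_top μ A) 1)
      (indicatorConstLp 2 hB (measure_ne_top μ B) 1), inner_lpTensor,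
      ← integral_indicator (hA.prod hB)]
    refine integral_congr_ae ?_
    filter_upwards [Measure.quasiMeasurePreserving_fst.ae
        (indicatorConstLp_coeFn (p := 2) (hs := hA) (hμs := measure_ne_top μ A) (c := (1 : ℂ))),
      Measure.quasiMeasurePreserving_snd.ae
        (indicatorConstLp_coeFn (p := 2) (hs := hB) (hμs := measure_ne_top μ B) (c := (1 : ℂ)))]
      with p h₁ h₂
    rw [h₁, h₂]
    by_cases hpA : p.1 ∈ A <;> by_cases hpB : p.2 ∈ B <;> simp [hpA, hpB, Set.indicator]
  -- Rectangles form a generating π-system.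
  have hset : ∀ s, MeasurableSet s → ∫ p in s, k p ∂(μ.prod μ) = 0 := by
    refine MeasurableSpace.induction_on_inter generateFrom_prod.symm isPiSystem_prod ?_ ?_ ?_ ?_
    · simp
    · rintro _ ⟨A, hA, B, hB, rfl⟩
      exact hrect A B hA hB
    · intro t ht h
      have := integral_add_compl ht hint
      rw [h, zero_add] at this
      rw [this, ← setIntegral_univ, ← Set.univ_prod_univ]
      exact hrect _ _ .univ .univ
    · intro t hd ht h
      rw [integral_iUnion ht hd hint.integrableOn]
      simp [h]
  exact (Lp.eq_zero_iff_ae_eq_zero).2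
    (hint.ae_eq_zero_of_forall_setIntegral_eq_zero fun s hs _ => hset s hs)

variable (μ) in
/-- The conjugate linear Hilbert-Schmidt operator with kernel `k`, that is
`x ↦ ∫ k (x, y) * conj (g y) dy`. -/
noncomputable def hilbertSchmidt : Lp ℂ 2 (μ.prod μ) →L[ℂ] Lp ℂ 2 μ →L⋆[ℂ] Lp ℂ 2 μ :=
  bilinAdjoint (lpTensor μ)

theorem inner_hilbertSchmidt (k : Lp ℂ 2 (μ.prod μ)) (f g : Lp ℂ 2 μ) :
    ⟪f, hilbertSchmidt μ k g⟫_ℂ = ⟪lpTensor μ f g, k⟫_ℂ :=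
  inner_bilinAdjoint (lpTensor μ) k f g

variable (μ) in
/-- The transpose of `hilbertSchmidt`, that is `y ↦ ∫ k (x, y) * conj (f x) dx`. -/
noncomputable def hilbertSchmidtTranspose :
    Lp ℂ 2 (μ.prod μ) →L[ℂ] Lp ℂ 2 μ →L⋆[ℂ] Lp ℂ 2 μ :=
  bilinAdjoint (lpTensor μ).flip

theorem inner_hilbertSchmidtTranspose (k : Lp ℂ 2 (μ.prod μ)) (f g : Lp ℂ 2 μ) :
    ⟪g, hilbertSchmidtTranspose μ k f⟫_ℂ = ⟪lpTensor μ f g, k⟫_ℂ :=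
  inner_bilinAdjoint (lpTensor μ).flip k g f

theorem hilbertSchmidt_lpTensor (f h g : Lp ℂ 2 μ) :
    hilbertSchmidt μ (lpTensor μ f h) g = ⟪g, h⟫_ℂ • f := by
  refine ext_inner_left ℂ fun v => ?_
  rw [inner_hilbertSchmidt, inner_lpTensor_lpTensor, inner_smul_right, mul_comm]

/-- Elementary tensors give operators of rank at most one, they span a dense subspace, and the
kernels with compact operator form a closed subspace. -/
theorem isCompactOperator_hilbertSchmidt (k : Lp ℂ 2 (μ.prod μ)) :
    IsCompactOperator (hilbertSchmidt μ k) := by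
  let K : Submodule ℂ (Lp ℂ 2 (μ.prod μ)) :=
    (compactOperator (starRingEnd ℂ) (Lp ℂ 2 μ) (Lp ℂ 2 μ)).comap (hilbertSchmidt μ).toLinearMap
  have hclosed : IsClosed (K : Set (Lp ℂ 2 (μ.prod μ))) :=
    isClosed_setOfPred_isCompactOperator.preimage (hilbertSchmidt μ).continuous
  have hmem : ∀ f h, lpTensor μ f h ∈ K := by
    intro f h
    change IsCompactOperator (hilbertSchmidt μ (lpTensor μ f h))
    have h₁ : IsCompactOperator (fun z : ℂ => z • f) :=
      isCompactOperator_of_locallyCompactSpace_rng (ContinuousLinearMap.toSpanSingleton ℂ f)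
    have h₂ := h₁.comp_clm (((innerSL ℂ : Lp ℂ 2 μ →L⋆[ℂ] Lp ℂ 2 μ →L[ℂ] ℂ)).flip h)
    have h₃ : ⇑(hilbertSchmidt μ (lpTensor μ f h)) = (fun z : ℂ => z • f) ∘
        ⇑((innerSL ℂ : Lp ℂ 2 μ →L⋆[ℂ] Lp ℂ 2 μ →L[ℂ] ℂ).flip h) :=
      funext fun g => hilbertSchmidt_lpTensor f h g
    rw [h₃]
    exact h₂
  have htop : K.topologicalClosure = ⊤ := by
    rw [Submodule.topologicalClosure_eq_top_iff, Submodule.eq_bot_iff]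
    exact fun k hk => eq_zero_of_inner_lpTensor_eq_zero fun f g => hk _ (hmem f g)
  rw [hclosed.submodule_topologicalClosure_eq] at htop
  have : k ∈ K := htop ▸ Submodule.mem_top
  exact this

/-- A function orthogonal to all finite dimensional subrepresentations is annihilated by every
invariant kernel. -/
theorem hilbertSchmidt_eq_zero_of_orthogonal {Γ : Type*} [Group Γ]
    {ρ : Γ →* (Lp ℂ 2 μ ≃ₗᵢ[ℂ] Lp ℂ 2 μ)} {k : Lp ℂ 2 (μ.prod μ)}
    (hk : ∀ γ f g, ⟪lpTensor μ (ρ γ f) (ρ γ g), k⟫_ℂ = ⟪lpTensor μ f g, k⟫_ℂ) {f : Lp ℂ 2 μ}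
    (hf : ∀ V, IsFiniteDimInvariant ρ V → f ∈ Vᗮ) : hilbertSchmidt μ k f = 0 := by
  set S := hilbertSchmidt μ k with hS
  set S' := hilbertSchmidtTranspose μ k with hS'
  have hadj : ∀ u v, ⟪v, S' u⟫_ℂ = ⟪u, S v⟫_ℂ := fun u v => by
    rw [hS, hS', inner_hilbertSchmidt, inner_hilbertSchmidtTranspose]
  have hcomm : ∀ γ g, S (ρ γ g) = ρ γ (S g) := fun γ g => by
    refine ext_inner_left ℂ fun v => ?_
    rw [← map_inv_apply_self (ρ := ρ) γ v, LinearIsometryEquiv.inner_map_map, hS,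
      inner_hilbertSchmidt, inner_hilbertSchmidt, hk]
  have hcomm' : ∀ γ g, S' (ρ γ g) = ρ γ (S' g) := fun γ g => by
    refine ext_inner_left ℂ fun v => ?_
    rw [← map_inv_apply_self (ρ := ρ) γ v, LinearIsometryEquiv.inner_map_map, hS',
      inner_hilbertSchmidtTranspose, inner_hilbertSchmidtTranspose, hk]
  -- Two conjugate linear maps compose to a linear one, so the spectral theorem applies to `T`;
  -- moreover `⟪f, T f⟫ = ‖S f‖²`.
  let T : Lp ℂ 2 μ →L[ℂ] Lp ℂ 2 μ := S'.comp S
  have hTin : ∀ u v, ⟪u, T v⟫_ℂ = ⟪S v, S u⟫_ℂ := fun u v => hadj _ _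
  have hT : T f = 0 := by
    refine apply_eq_zero_of_orthogonal_isFiniteDimInvariant (ρ := ρ)
      ((isCompactOperator_hilbertSchmidt k).clm_comp S') (fun u v => ?_) (fun γ g => ?_) hf
    · change ⟪T u, v⟫_ℂ = ⟪u, T v⟫_ℂ
      rw [hTin, ← inner_conj_symm, hTin, inner_conj_symm]
    · change S' (S (ρ γ g)) = ρ γ (S' (S g))
      rw [hcomm, hcomm']
  have := hTin f f
  rwa [hT, inner_zero_right, eq_comm, inner_self_eq_zero] at this

end HilbertSchmidt

/-! ### Invariant kernels and ergodicity -/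

section DiagonalAction

variable {Γ X : Type*} [Group Γ] [MeasurableSpace X] [MulAction Γ X] [MeasurableConstSMul Γ X]
  {μ : Measure X} [IsProbabilityMeasure μ]

theorem measurePreserving_smul_diag [SMulInvariantMeasure Γ X μ] (γ : Γ) :
    MeasurePreserving (fun p : X × X => (γ • p.1, γ • p.2)) (μ.prod μ) (μ.prod μ) :=
  (measurePreserving_smul γ μ).prod (measurePreserving_smul γ μ)

theorem measurableEmbedding_smul_diag (γ : Γ) :
    MeasurableEmbedding (fun p : X × X => (γ • p.1, γ • p.2)) :=
  (measurableEmbedding_const_smul γ).prodMap (measurableEmbedding_const_smul γ)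

/-- Change of variables by `γ⁻¹` on the product; this is the equivariance required by
`hilbertSchmidt_eq_zero_of_orthogonal`. -/
theorem inner_lpTensor_koopmanRep [SMulInvariantMeasure Γ X μ] {k : Lp ℂ 2 (μ.prod μ)}
    (hk : ∀ γ : Γ, (fun p : X × X => k (γ • p.1, γ • p.2)) =ᵐ[μ.prod μ] k) (γ : Γ)
    (f g : Lp ℂ 2 μ) :
    ⟪lpTensor μ (koopmanRep Γ μ γ f) (koopmanRep Γ μ γ g), k⟫_ℂ = ⟪lpTensor μ f g, k⟫_ℂ := by
  rw [inner_lpTensor, inner_lpTensor, ← (measurePreserving_smul_diag (μ := μ) γ⁻¹).integral_comp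
    (measurableEmbedding_smul_diag γ⁻¹) fun p => conj (f p.1) * conj (g p.2) * k p]
  refine integral_congr_ae ?_
  filter_upwards [Measure.quasiMeasurePreserving_fst.ae (koopmanRep_ae_eq μ γ f),
    Measure.quasiMeasurePreserving_snd.ae (koopmanRep_ae_eq μ γ g), hk γ⁻¹] with p h₁ h₂ h₃
  rw [h₁, h₂, h₃]

variable (Γ)

-- Preimages of measurable sets are invariant up to null sets, hence null or conull, and countably
-- many measurable sets separate the points of `ℝ`.
omit [MeasurableConstSMul Γ X] [IsProbabilityMeasure μ] in
theorem ErgodicSMul.ae_eq_const [ErgodicSMul Γ X μ] {q : X → ℝ} (hq : NullMeasurable q μ)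
    (h : ∀ γ : Γ, (fun x => q (γ • x)) =ᵐ[μ] q) : ∃ c, ∀ᵐ x ∂μ, q x = c := by
  refine exists_eventuallyEq_const_of_forall_separating MeasurableSet fun U hU => ?_
  have hc := MeasureTheory.aeconst_of_forall_preimage_smul_ae_eq Γ (μ := μ) (hq hU) fun γ => by
    filter_upwards [h γ] with x hx
    change (q (γ • x) ∈ U) = (q x ∈ U)
    rw [hx]
  rcases Filter.eventuallyConst_set.1 hc with h | h
  · exact .inl h
  · exact .inr h

/-- An invariant kernel has constant marginals. -/
theorem ae_integral_snd_eq_of_invariant [ErgodicSMul Γ X μ] {k : X × X → ℝ}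
    (hk : Integrable k (μ.prod μ))
    (hinv : ∀ γ : Γ, (fun p : X × X => k (γ • p.1, γ • p.2)) =ᵐ[μ.prod μ] k) :
    ∀ᵐ x ∂μ, ∫ y, k (x, y) ∂μ = ∫ p, k p ∂(μ.prod μ) := by
  obtain ⟨c, hc⟩ := ErgodicSMul.ae_eq_const Γ (μ := μ) (q := fun x => ∫ y, k (x, y) ∂μ)
    hk.integral_prod_left.aestronglyMeasurable.aemeasurable.nullMeasurable fun γ => by
      filter_upwards [Measure.ae_ae_of_ae_prod (hinv γ)] with x hx
      -- Substituting `γ • y` for `y` shows that the marginal is an invariant function.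
      rw [← (measurePreserving_smul γ μ).integral_comp (measurableEmbedding_const_smul γ)]
      exact integral_congr_ae hx
  filter_upwards [hc] with x hx
  rw [hx, integral_prod k hk, integral_congr_ae hc]
  simp

theorem ae_integral_fst_eq_of_invariant [ErgodicSMul Γ X μ] {k : X × X → ℝ}
    (hk : Integrable k (μ.prod μ))
    (hinv : ∀ γ : Γ, (fun p : X × X => k (γ • p.1, γ • p.2)) =ᵐ[μ.prod μ] k) :
    ∀ᵐ y ∂μ, ∫ x, k (x, y) ∂μ = ∫ p, k p ∂(μ.prod μ) := by
  have := ae_integral_snd_eq_of_invariant Γ (k := k ∘ Prod.swap) hk.swap fun γ =>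
    Measure.measurePreserving_swap.quasiMeasurePreserving.ae_eq_comp (hinv γ)
  have hswap := integral_prod_swap (μ := μ) (ν := μ) k
  simpa only [Function.comp_apply, Prod.swap_prod_mk, hswap] using this

end DiagonalAction

/-! ### Truncated densities and the basic estimate -/

section Truncation

variable {X : Type*} [MeasurableSpace X] {μ : Measure X} [IsProbabilityMeasure μ]

/-- A density is only integrable; truncation makes it square integrable, and dominated convergence
keeps its mass away from `0`. -/
theorem exists_integral_min_ge {Y : Type*} [MeasurableSpace Y] {ν : Measure Y} {η : Y → ℝ}
    (hη : Integrable η ν) (h1 : ∫ y, |η y| ∂ν = 1) :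
    ∃ C : ℝ, 0 ≤ C ∧ 1 / 2 ≤ ∫ y, min |η y| C ∂ν := by
  have hlim : Tendsto (fun n : ℕ => ∫ y, min |η y| (n : ℝ) ∂ν) atTop (𝓝 (∫ y, |η y| ∂ν)) := by
    refine tendsto_integral_of_dominated_convergence (fun y => |η y|)
      (fun n => hη.abs.aestronglyMeasurable.inf aestronglyMeasurable_const) hη.abs
      (fun n => ae_of_all _ fun y => ?_) (ae_of_all _ fun y => ?_)
    · rw [Real.norm_of_nonneg (by positivity)]
      exact min_le_left _ _
    · obtain ⟨N, hN⟩ := exists_nat_ge |η y|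
      refine tendsto_const_nhds.congr' ?_
      filter_upwards [eventually_ge_atTop N] with n hn
      rw [min_eq_left (hN.trans (Nat.cast_le.2 hn))]
  rw [h1] at hlim
  obtain ⟨n, hn⟩ := (hlim.eventually (eventually_ge_nhds (by norm_num : (1 / 2 : ℝ) < 1))).exists
  exact ⟨n, n.cast_nonneg, hn⟩

/-- If the kernel `k` has constant marginal `c` and `∫∫ 1_A(x) conj (f y) k(x,y) = 0`, then
`c ∫_A f` is controlled by the mass that `k` gives to pairs separated by `A`. -/
theorem norm_setIntegral_le_of_kernel {k : X × X → ℝ} {c C R δ : ℝ} (hR : 0 < R)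
    (hkm : AEStronglyMeasurable k (μ.prod μ)) (hk0 : ∀ p, 0 ≤ k p) (hkC : ∀ p, k p ≤ C)
    (hc0 : 0 ≤ c) (hc : ∀ᵐ y ∂μ, ∫ x, k (x, y) ∂μ = c) {A : Set X} (hA : MeasurableSet A)
    (hδ : ∫ p in A ×ˢ Aᶜ ∪ Aᶜ ×ˢ A, k p ∂(μ.prod μ) ≤ δ) {f : X → ℂ} (hf : MemLp f 2 μ)
    (h0 : ∫ p in A ×ˢ Set.univ, conj (f p.2) * k p ∂(μ.prod μ) = 0) :
    c * ‖∫ x in A, f x ∂μ‖ ≤ R * δ + c * (∫ x, ‖f x‖ ^ 2 ∂μ) / R := by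
  have hf1 : Integrable f μ := hf.integrable one_le_two
  have hf2 : Integrable (fun x => ‖f x‖ ^ 2) μ := hf.integrable_norm_pow two_ne_zero
  have hkbd : ∀ p, ‖k p‖ ≤ C := fun p => by rw [Real.norm_of_nonneg (hk0 p)]; exact hkC p
  have hk1 : Integrable k (μ.prod μ) := .of_bound hkm C (ae_of_all _ hkbd)
  have hkc : Integrable (fun p => conj (f p.2) * (k p : ℂ)) (μ.prod μ) := by
    refine Integrable.mul_bdd (c := C) ?_
      (Complex.continuous_ofReal.comp_aestronglyMeasurable hkm) (ae_of_all _ fun p => by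
      simpa using hkbd p)
    exact Complex.conjCLE.toContinuousLinearMap.integrable_comp (hf1.comp_snd μ)
  have hkn : Integrable (fun p => ‖f p.2‖ ^ 2 * k p) (μ.prod μ) :=
    (hf2.comp_snd μ).mul_bdd (c := C) hkm (ae_of_all _ hkbd)
  have hkn_int : ∫ p, ‖f p.2‖ ^ 2 * k p ∂(μ.prod μ) = c * ∫ x, ‖f x‖ ^ 2 ∂μ := by
    rw [integral_prod_symm _ hkn, ← integral_const_mul]
    refine integral_congr_ae ?_
    filter_upwards [hc] with y hy
    simp only [integral_const_mul, hy, mul_comm]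
  have hkA : ∫ p in Set.univ ×ˢ A, conj (f p.2) * k p ∂(μ.prod μ) = c * conj (∫ x in A, f x ∂μ) := by
    rw [← Measure.prod_restrict, Measure.restrict_univ, integral_prod_symm _ (by
      rw [← Measure.restrict_univ (μ := μ), Measure.prod_restrict, Measure.restrict_univ]
      exact hkc.integrableOn), ← integral_conj, ← integral_const_mul]
    refine integral_congr_ae ?_
    filter_upwards [ae_restrict_of_ae hc] with y hy
    rw [integral_const_mul, integral_complex_ofReal, hy, mul_comm]
  set D : Set (X × X) := A ×ˢ Aᶜ ∪ Aᶜ ×ˢ A with hD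
  have hDm : MeasurableSet D := (hA.prod hA.compl).union (hA.compl.prod hA)
  -- The difference vanishes off `D`. On `D`, `‖f‖ ≤ R + ‖f‖² / R` splits it into a part seeing only
  -- the mass of `D` and a part integrated through the marginal of `k`.
  have hle : ∀ p : X × X, ‖(Set.univ ×ˢ A).indicator (fun p => conj (f p.2) * (k p : ℂ)) p -
      (A ×ˢ Set.univ).indicator (fun p => conj (f p.2) * (k p : ℂ)) p‖ ≤
      R * D.indicator k p + ‖f p.2‖ ^ 2 * k p / R := by
    intro p
    have h1 : ‖conj (f p.2) * (k p : ℂ)‖ ≤ R * k p + ‖f p.2‖ ^ 2 * k p / R := by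
      rw [norm_mul, RCLike.norm_conj, Complex.norm_real, Real.norm_of_nonneg (hk0 p)]
      have : ‖f p.2‖ ≤ R + ‖f p.2‖ ^ 2 / R := by
        rw [← sub_le_iff_le_add', le_div_iff₀ hR]
        nlinarith [sq_nonneg (‖f p.2‖ - R), sq_nonneg (‖f p.2‖)]
      calc ‖f p.2‖ * k p ≤ (R + ‖f p.2‖ ^ 2 / R) * k p := by gcongr; exact hk0 p
        _ = _ := by ring
    have h2 : 0 ≤ ‖f p.2‖ ^ 2 * k p / R := by have := hk0 p; positivity
    by_cases h₁ : p.1 ∈ A <;> by_cases h₂ : p.2 ∈ A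
    · simpa [hD, Set.indicator, h₁, h₂] using h2
    · simpa [hD, Set.indicator, h₁, h₂] using h1
    · simpa [hD, Set.indicator, h₁, h₂] using h1
    · simpa [hD, Set.indicator, h₁, h₂] using h2
  calc c * ‖∫ x in A, f x ∂μ‖
      = ‖∫ p in Set.univ ×ˢ A, conj (f p.2) * k p ∂(μ.prod μ) -
          ∫ p in A ×ˢ Set.univ, conj (f p.2) * k p ∂(μ.prod μ)‖ := by
        rw [hkA, h0, sub_zero, norm_mul, RCLike.norm_conj, Complex.norm_real,
          Real.norm_of_nonneg hc0]
    _ = ‖∫ p, ((Set.univ ×ˢ A).indicator (fun p => conj (f p.2) * (k p : ℂ)) p -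
          (A ×ˢ Set.univ).indicator (fun p => conj (f p.2) * (k p : ℂ)) p) ∂(μ.prod μ)‖ := by
        rw [integral_sub (hkc.indicator (.prod .univ hA)) (hkc.indicator (hA.prod .univ)),
          integral_indicator (.prod .univ hA), integral_indicator (hA.prod .univ)]
    _ ≤ ∫ p, (R * D.indicator k p + ‖f p.2‖ ^ 2 * k p / R) ∂(μ.prod μ) :=
        norm_integral_le_of_norm_le (((hk1.indicator hDm).const_mul R).add (hkn.div_const R))
          (ae_of_all _ hle)
    _ = R * ∫ p in D, k p ∂(μ.prod μ) + c * (∫ x, ‖f x‖ ^ 2 ∂μ) / R := by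
        rw [integral_add ((hk1.indicator hDm).const_mul R) (hkn.div_const R), integral_const_mul,
          integral_div, hkn_int, integral_indicator hDm]
    _ ≤ _ := by gcongr

end Truncation

/-! ### From concentrating invariant densities to compactness -/

section KernelsToCompact

variable {Γ X : Type*} [Group Γ] [MeasurableSpace X] [MulAction Γ X] [MeasurableConstSMul Γ X]
  {μ : Measure X} [IsProbabilityMeasure μ]

theorem integral_abs_eq_one {Y : Type*} [MeasurableSpace Y] {ν : Measure Y} {η : Lp ℝ 1 ν}
    (h1 : ‖η‖ = 1) : ∫ y, |η y| ∂ν = 1 := by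
  rw [← h1, L1.norm_eq_integral_norm]
  rfl

theorem setIntegral_abs_eq_toReal_eLpNorm_indicator {Y : Type*} [MeasurableSpace Y]
    {ν : Measure Y} (η : Lp ℝ 1 ν) {s : Set Y} (hs : MeasurableSet s) :
    ∫ y in s, |η y| ∂ν = (eLpNorm (s.indicator η) 1 ν).toReal := by
  rw [eLpNorm_indicator_eq_eLpNorm_restrict hs, eLpNorm_one_eq_lintegral_enorm,
    ← integral_norm_eq_lintegral_enorm (Lp.aestronglyMeasurable η).restrict]
  rfl

/-- Functions orthogonal to all finite dimensional subrepresentations have small integrals, in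
terms of the mass which an invariant probability density gives to separated pairs. -/
theorem norm_setIntegral_le_of_invariant_density [ErgodicSMul Γ X μ] {η : Lp ℝ 1 (μ.prod μ)}
    (hinv : ∀ γ : Γ, (fun p : X × X => η (γ • p.1, γ • p.2)) =ᵐ[μ.prod μ] η) (h1 : ‖η‖ = 1)
    {f : Lp ℂ 2 μ} (hf : ∀ V, IsFiniteDimInvariant (koopmanRep Γ μ) V → f ∈ Vᗮ)
    {A : Set X} (hA : MeasurableSet A) {R : ℝ} (hR : 0 < R) :
    1 / 2 * ‖∫ x in A, f x ∂μ‖ ≤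
      R * ((eLpNorm ((A ×ˢ Aᶜ).indicator η) 1 (μ.prod μ)).toReal +
        (eLpNorm ((Aᶜ ×ˢ A).indicator η) 1 (μ.prod μ)).toReal) + (∫ x, ‖f x‖ ^ 2 ∂μ) / R := by
  have hη : Integrable η (μ.prod μ) := L1.integrable_coeFn η
  have habs := integral_abs_eq_one h1
  obtain ⟨C, hC0, hC⟩ := exists_integral_min_ge hη habs
  set k : X × X → ℝ := fun p => min |η p| C with hk
  have hkm : AEStronglyMeasurable k (μ.prod μ) :=
    hη.abs.aestronglyMeasurable.inf aestronglyMeasurable_const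
  have hk0 : ∀ p, 0 ≤ k p := fun p => le_min (abs_nonneg _) hC0
  have hkC : ∀ p, k p ≤ C := fun p => min_le_right _ _
  have hkη : ∀ p, k p ≤ |η p| := fun p => min_le_left _ _
  have hkbd : ∀ p, ‖k p‖ ≤ C := fun p => by rw [Real.norm_of_nonneg (hk0 p)]; exact hkC p
  have hk1 : Integrable k (μ.prod μ) := .of_bound hkm C (ae_of_all _ hkbd)
  have hkinv : ∀ γ : Γ, (fun p : X × X => k (γ • p.1, γ • p.2)) =ᵐ[μ.prod μ] k := fun γ => by
    filter_upwards [hinv γ] with p hp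
    simp only [hk, hp]
  set c : ℝ := ∫ p, k p ∂(μ.prod μ) with hc
  have hc1 : c ≤ 1 := habs ▸ integral_mono hk1 hη.abs hkη
  have hmarg := ae_integral_fst_eq_of_invariant Γ hk1 hkinv
  have hKmem : MemLp (fun p => (k p : ℂ)) 2 (μ.prod μ) :=
    .of_bound (Complex.continuous_ofReal.comp_aestronglyMeasurable hkm) C
      (ae_of_all _ fun p => by simpa using hkbd p)
  set K : Lp ℂ 2 (μ.prod μ) := hKmem.toLp _ with hK
  have hKk : K =ᵐ[μ.prod μ] fun p => (k p : ℂ) := hKmem.coeFn_toLp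
  have hKinv : ∀ γ : Γ, (fun p : X × X => K (γ • p.1, γ • p.2)) =ᵐ[μ.prod μ] K := fun γ => by
    have h := (measurePreserving_smul_diag (μ := μ) γ).quasiMeasurePreserving.ae_eq_comp hKk
    filter_upwards [h, hKk, hkinv γ] with p h₁ h₂ h₃
    simp only [Function.comp_apply] at h₁
    rw [h₁, h₂, h₃]
  have hS := hilbertSchmidt_eq_zero_of_orthogonal (inner_lpTensor_koopmanRep hKinv) hf
  -- This integral is the pairing of `1_A` with the vanishing vector `hilbertSchmidt μ K f`.
  have h0 : ∫ p in A ×ˢ Set.univ, conj (f p.2) * k p ∂(μ.prod μ) = 0 := by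
    have h := inner_hilbertSchmidt K (indicatorConstLp 2 hA (measure_ne_top μ A) 1) f
    rw [hS, inner_zero_right, inner_lpTensor] at h
    rw [h, ← integral_indicator (hA.prod .univ)]
    refine integral_congr_ae ?_
    filter_upwards [hKk, Measure.quasiMeasurePreserving_fst.ae
      (indicatorConstLp_coeFn (p := 2) (hs := hA) (hμs := measure_ne_top μ A) (c := (1 : ℂ)))]
      with p h₁ h₂
    rw [h₁, h₂]
    by_cases hp : p.1 ∈ A <;> simp [hp, Set.indicator]
  have hδ : ∫ p in A ×ˢ Aᶜ ∪ Aᶜ ×ˢ A, k p ∂(μ.prod μ) ≤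
      (eLpNorm ((A ×ˢ Aᶜ).indicator η) 1 (μ.prod μ)).toReal +
        (eLpNorm ((Aᶜ ×ˢ A).indicator η) 1 (μ.prod μ)).toReal := by
    rw [← setIntegral_abs_eq_toReal_eLpNorm_indicator η (hA.prod hA.compl),
      ← setIntegral_abs_eq_toReal_eLpNorm_indicator η (hA.compl.prod hA),
      ← setIntegral_union (Set.disjoint_left.2 fun p hp hp' => hp'.1 hp.1) (hA.compl.prod hA)
        hη.abs.integrableOn hη.abs.integrableOn]
    exact setIntegral_mono hk1.integrableOn hη.abs.integrableOn hkη
  have hmain := norm_setIntegral_le_of_kernel hR hkm hk0 hkC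
    (by linarith : (0 : ℝ) ≤ c) hmarg hA hδ (Lp.memLp f) h0
  refine (mul_le_mul_of_nonneg_right hC (norm_nonneg _)).trans (hmain.trans ?_)
  have hN : 0 ≤ ∫ x, ‖f x‖ ^ 2 ∂μ := integral_nonneg fun x => by positivity
  gcongr
  exact mul_le_of_le_one_left hN hc1

/-- In the estimate for `∫_A f`, let `n` tend to infinity at fixed `R`, and only then make `R`
large. -/
theorem isCompactAction_of_invariant_densities [ErgodicSMul Γ X μ] (η : ℕ → Lp ℝ 1 (μ.prod μ))
    (hinv : ∀ n, ∀ γ : Γ, (fun p : X × X => η n (γ • p.1, γ • p.2)) =ᵐ[μ.prod μ] η n)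
    (h1 : ∀ n, ‖η n‖ = 1)
    (hlim : ∀ A : Set X, MeasurableSet A →
      Tendsto (fun n => eLpNorm ((A ×ˢ Aᶜ).indicator (η n)) 1 (μ.prod μ)) atTop (𝓝 0)) :
    IsCompactAction Γ μ := by
  refine exists_isHilbertSum_of_isFiniteDimInvariant (ρ := koopmanRep Γ μ) fun f hf => ?_
  have hint : Integrable f μ := (Lp.memLp f).integrable one_le_two
  refine Lp.eq_zero_iff_ae_eq_zero.2
    (hint.ae_eq_zero_of_forall_setIntegral_eq_zero fun A hA _ => ?_)
  have hlim' : ∀ B : Set X, MeasurableSet B →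
      Tendsto (fun n => (eLpNorm ((B ×ˢ Bᶜ).indicator (η n)) 1 (μ.prod μ)).toReal)
        atTop (𝓝 0) := fun B hB => (ENNReal.tendsto_toReal ENNReal.zero_ne_top).comp (hlim B hB)
  have hA' := hlim' Aᶜ hA.compl
  rw [compl_compl] at hA'
  set N := ∫ x, ‖f x‖ ^ 2 ∂μ
  have hN : 0 ≤ N := integral_nonneg fun x => by positivity
  have hle : ∀ R : ℝ, 0 < R → 1 / 2 * ‖∫ x in A, f x ∂μ‖ ≤ N / R := by
    intro R hR
    have ht := (((hlim' A hA).add hA').const_mul R).add_const (N / R)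
    rw [add_zero, mul_zero, zero_add] at ht
    exact ge_of_tendsto' ht fun n =>
      norm_setIntegral_le_of_invariant_density (hinv n) (h1 n) hf hA hR
  by_contra hne
  have hpos : 0 < ‖∫ x in A, f x ∂μ‖ := norm_pos_iff.2 hne
  -- This `R` turns the bound into `N + 1 ≤ N`.
  have h := hle ((2 * N + 2) / ‖∫ x in A, f x ∂μ‖) (by positivity)
  rw [le_div_iff₀ (by positivity)] at h
  have : 1 / 2 * ‖∫ x in A, f x ∂μ‖ * ((2 * N + 2) / ‖∫ x in A, f x ∂μ‖) = N + 1 := by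
    field_simp
  linarith

end KernelsToCompact

/-! ### Invariant densities from finite dimensional subrepresentations -/

section CompactToKernels

/-- The transition matrix between orthonormal bases is unitary: both sides are the squared norm of
one vector, by Parseval in either basis. -/
theorem sum_sq_norm_sum_inner_mul {V ι : Type*} [NormedAddCommGroup V] [InnerProductSpace ℂ V]
    [Fintype ι] (b b' : OrthonormalBasis ι ℂ V) (v : ι → ℂ) :
    ∑ i, ‖∑ j, ⟪b j, b' i⟫_ℂ * v j‖ ^ 2 = ∑ j, ‖v j‖ ^ 2 := by
  set w : V := ∑ j, conj (v j) • b j with hw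
  have h₁ : ∀ i, ⟪w, b' i⟫_ℂ = ∑ j, ⟪b j, b' i⟫_ℂ * v j := fun i => by
    rw [hw, sum_inner]
    refine Finset.sum_congr rfl fun j _ => ?_
    rw [inner_smul_left, Complex.conj_conj, mul_comm]
  have h₂ : ∀ j, ⟪w, b j⟫_ℂ = v j := fun j => by
    classical
    rw [hw, sum_inner, Finset.sum_eq_single j]
    · rw [inner_smul_left, Complex.conj_conj, inner_self_eq_norm_sq_to_K, b.norm_eq_one]
      simp
    · intro i _ hij
      rw [inner_smul_left, b.inner_eq_zero hij, mul_zero]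
    · simp
  simp_rw [← h₁, ← h₂]
  rw [b.sum_sq_norm_inner_left, b'.sum_sq_norm_inner_left]

/-- Countably many balls of radius `ε / 2` cover `M`, so one has a preimage `B` of positive measure,
and `B ×ˢ B` lies in the set. -/
theorem prod_setOf_dist_lt_pos {X M : Type*} [MeasurableSpace X] {μ : Measure X} [SFinite μ]
    [NeZero μ] [PseudoMetricSpace M] [TopologicalSpace.SeparableSpace M] (φ : X → M) {ε : ℝ}
    (hε : 0 < ε) : 0 < (μ.prod μ) {p : X × X | dist (φ p.1) (φ p.2) < ε} := by
  have : Nonempty X := μ.nonempty_of_neZero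
  have : Nonempty M := Nonempty.map φ this
  have hcover : ⋃ n, φ ⁻¹' Metric.ball (TopologicalSpace.denseSeq M n) (ε / 2) = Set.univ := by
    refine Set.eq_univ_of_forall fun x => Set.mem_iUnion.2 ?_
    exact (TopologicalSpace.denseRange_denseSeq M).exists_dist_lt (φ x) (half_pos hε)
  obtain ⟨n, hn⟩ : ∃ n, μ (φ ⁻¹' Metric.ball (TopologicalSpace.denseSeq M n) (ε / 2)) ≠ 0 := by
    by_contra! h
    have h0 := measure_iUnion_null h
    rw [hcover] at h0
    exact NeZero.ne μ (Measure.measure_univ_eq_zero.1 h0)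
  set B := φ ⁻¹' Metric.ball (TopologicalSpace.denseSeq M n) (ε / 2)
  calc 0 < μ B * μ B := ENNReal.mul_pos hn hn
    _ = (μ.prod μ) (B ×ˢ B) := (Measure.prod_prod B B).symm
    _ ≤ _ := measure_mono fun p hp => by
      have h₁ := Metric.mem_ball.1 hp.1
      have h₂ := Metric.mem_ball'.1 hp.2
      calc dist (φ p.1) (φ p.2) ≤ _ := dist_triangle _ (TopologicalSpace.denseSeq M n) _
        _ < ε / 2 + ε / 2 := add_lt_add h₁ h₂
        _ = ε := add_halves ε

variable {Γ X : Type*} [Group Γ] [MeasurableSpace X] [MulAction Γ X] [MeasurableConstSMul Γ X]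
  {μ : Measure X}

theorem Lp.coeFn_finset_sum {ι : Type*} (s : Finset ι) (f : ι → Lp ℂ 2 μ) :
    ((∑ i ∈ s, f i : Lp ℂ 2 μ) : X → ℂ) =ᵐ[μ] fun x => ∑ i ∈ s, f i x := by
  classical
  induction s using Finset.induction_on with
  | empty =>
    simp only [Finset.sum_empty]
    exact Lp.coeFn_zero ℂ 2 μ
  | insert a s ha ih =>
    simp only [Finset.sum_insert ha]
    filter_upwards [Lp.coeFn_add (f a) (∑ i ∈ s, f i), ih] with x h₁ h₂
    rw [h₁, Pi.add_apply, h₂]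

theorem ae_eq_sum_repr {ι : Type*} [Fintype ι] {V : Submodule ℂ (Lp ℂ 2 μ)}
    (b : OrthonormalBasis ι ℂ V) (f : V) :
    ((f : Lp ℂ 2 μ) : X → ℂ) =ᵐ[μ] fun x => ∑ j, ⟪b j, f⟫_ℂ * (b j : Lp ℂ 2 μ) x := by
  have hf : (f : Lp ℂ 2 μ) = ∑ j, ⟪b j, f⟫_ℂ • (b j : Lp ℂ 2 μ) := by
    conv_lhs => rw [← b.sum_repr' f]
    simp
  have hsm : ∀ᵐ x ∂μ, ∀ j, (⟪b j, f⟫_ℂ • (b j : Lp ℂ 2 μ) : Lp ℂ 2 μ) x =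
      ⟪b j, f⟫_ℂ * (b j : Lp ℂ 2 μ) x := by
    refine ae_all_iff.2 fun j => ?_
    filter_upwards [Lp.coeFn_smul (⟪b j, f⟫_ℂ) (b j : Lp ℂ 2 μ)] with x hx
    rw [hx, Pi.smul_apply, smul_eq_mul]
  have hsum := Lp.coeFn_finset_sum Finset.univ fun j => ⟪b j, f⟫_ℂ • (b j : Lp ℂ 2 μ)
  rw [← hf] at hsum
  filter_upwards [hsum, hsm] with x h₁ h₂
  rw [h₁]
  exact Finset.sum_congr rfl fun j _ => h₂ j

/-- The unitary representation restricted to an invariant subspace, at one group element. -/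
noncomputable def IsFiniteDimInvariant.restrict {H : Type*} [NormedAddCommGroup H]
    [InnerProductSpace ℂ H] {ρ : Γ →* (H ≃ₗᵢ[ℂ] H)} {V : Submodule ℂ H}
    (hV : IsFiniteDimInvariant ρ V) (γ : Γ) : V ≃ₗᵢ[ℂ] V where
  toLinearEquiv := LinearEquiv.ofLinearMap
    ((ρ γ).toLinearEquiv.toLinearMap.restrict (hV.2 γ))
    ((ρ γ⁻¹).toLinearEquiv.toLinearMap.restrict (hV.2 γ⁻¹))
    (by ext v; exact map_inv_apply_self γ (v : H))
    (by ext v; exact map_apply_inv_self γ (v : H))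
  norm_map' v := (ρ γ).norm_map (v : H)

theorem IsFiniteDimInvariant.coe_restrict {H : Type*} [NormedAddCommGroup H]
    [InnerProductSpace ℂ H] {ρ : Γ →* (H ≃ₗᵢ[ℂ] H)} {V : Submodule ℂ H}
    (hV : IsFiniteDimInvariant ρ V) (γ : Γ) (v : V) : (hV.restrict γ v : H) = ρ γ v := rfl

/-- The squared distance `∑ |b_i x - b_i y|²` is invariant under the diagonal action. -/
theorem ae_sum_sq_norm_sub_smul [IsProbabilityMeasure μ] [SMulInvariantMeasure Γ X μ] {ι : Type*}
    [Fintype ι] {V : Submodule ℂ (Lp ℂ 2 μ)} (hV : IsFiniteDimInvariant (koopmanRep Γ μ) V)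
    (b : OrthonormalBasis ι ℂ V) (γ : Γ) :
    ∀ᵐ p : X × X ∂(μ.prod μ),
      ∑ i, ‖(b i : Lp ℂ 2 μ) (γ • p.1) - (b i : Lp ℂ 2 μ) (γ • p.2)‖ ^ 2 =
        ∑ i, ‖(b i : Lp ℂ 2 μ) p.1 - (b i : Lp ℂ 2 μ) p.2‖ ^ 2 := by
  -- Almost everywhere `b i (γ • x) = b' i x`, with `b'` another orthonormal basis of `V`.
  set b' := b.map (hV.restrict γ⁻¹) with hb'
  have hx : ∀ᵐ x ∂μ, ∀ i, (b i : Lp ℂ 2 μ) (γ • x) =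
      ∑ j, ⟪b j, b' i⟫_ℂ * (b j : Lp ℂ 2 μ) x := by
    refine ae_all_iff.2 fun i => ?_
    have h₁ := koopmanRep_ae_eq μ γ⁻¹ (b i : Lp ℂ 2 μ)
    rw [← hV.coe_restrict] at h₁
    filter_upwards [h₁, ae_eq_sum_repr b (b' i)] with x h₁ h₂
    rw [inv_inv] at h₁
    rw [← h₁, ← h₂, hb', OrthonormalBasis.map_apply]
  filter_upwards [Measure.quasiMeasurePreserving_fst.ae hx,
    Measure.quasiMeasurePreserving_snd.ae hx] with p h₁ h₂
  rw [← sum_sq_norm_sum_inner_mul b b' fun j => (b j : Lp ℂ 2 μ) p.1 - (b j : Lp ℂ 2 μ) p.2]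
  refine Finset.sum_congr rfl fun i _ => ?_
  rw [h₁, h₂, ← Finset.sum_sub_distrib]
  simp_rw [mul_sub]

/-- An invariant probability density, supported on pairs of points at which each function of a
finite dimensional subrepresentation takes nearby values. -/
theorem exists_invariant_density [IsProbabilityMeasure μ] [SMulInvariantMeasure Γ X μ]
    {V : Submodule ℂ (Lp ℂ 2 μ)} (hV : IsFiniteDimInvariant (koopmanRep Γ μ) V) {ε : ℝ}
    (hε : 0 < ε) :
    ∃ η : Lp ℝ 1 (μ.prod μ),
      (∀ γ : Γ, (fun p : X × X => η (γ • p.1, γ • p.2)) =ᵐ[μ.prod μ] η) ∧ 0 ≤ η ∧ ‖η‖ = 1 ∧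
      ∀ f ∈ V, ∀ᵐ p ∂(μ.prod μ), η p ≠ 0 → ‖f p.1 - f p.2‖ ≤ ‖f‖ * ε := by
  have := hV.1
  set b := stdOrthonormalBasis ℂ V
  set φ : X → EuclideanSpace ℂ (Fin (Module.finrank ℂ V)) := fun x =>
    WithLp.toLp 2 fun i => (b i : Lp ℂ 2 μ) x with hφ
  have hφm : Measurable φ := by
    refine (WithLp.measurable_toLp 2 _).comp (measurable_pi_lambda _ fun i => ?_)
    exact (Lp.stronglyMeasurable (b i : Lp ℂ 2 μ)).measurable
  set E : Set (X × X) := {p | dist (φ p.1) (φ p.2) < ε} with hE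
  have hEm : MeasurableSet E :=
    measurableSet_lt ((hφm.comp measurable_fst).dist (hφm.comp measurable_snd)) measurable_const
  have hdist : ∀ x y, dist (φ x) (φ y) =
      √(∑ i, ‖(b i : Lp ℂ 2 μ) x - (b i : Lp ℂ 2 μ) y‖ ^ 2) := fun x y => by
    rw [EuclideanSpace.dist_eq]
    simp only [hφ, dist_eq_norm]
  have hEpos : 0 < (μ.prod μ).real E :=
    ENNReal.toReal_pos (prod_setOf_dist_lt_pos φ hε).ne' (measure_ne_top _ _)
  set k : X × X → ℝ := E.indicator fun _ => ((μ.prod μ).real E)⁻¹ with hk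
  have hkint : Integrable k (μ.prod μ) := (integrable_const _).indicator hEm
  have hkinv : ∀ γ : Γ, (fun p : X × X => k (γ • p.1, γ • p.2)) =ᵐ[μ.prod μ] k := fun γ => by
    filter_upwards [ae_sum_sq_norm_sub_smul hV b γ] with p hp
    have hiff : (γ • p.1, γ • p.2) ∈ E ↔ p ∈ E := by
      simp only [hE, Set.mem_ofPred_eq, hdist, hp]
    simp only [hk, Set.indicator, hiff]
  have hk0 : 0 ≤ k := Set.indicator_nonneg fun _ _ => inv_nonneg.2 hEpos.le
  have hη : hkint.toL1 k =ᵐ[μ.prod μ] k := hkint.coeFn_toL1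
  refine ⟨hkint.toL1 k, fun γ => ?_, ?_, ?_, fun f hf => ?_⟩
  · have h := (measurePreserving_smul_diag (μ := μ) γ).quasiMeasurePreserving.ae_eq_comp hη
    exact h.trans ((hkinv γ).trans hη.symm)
  · rw [← Lp.coeFn_nonneg]
    filter_upwards [hη] with p hp
    rw [hp]
    exact hk0 p
  · rw [L1.norm_eq_integral_norm]
    calc ∫ p, ‖hkint.toL1 k p‖ ∂(μ.prod μ) = ∫ p, k p ∂(μ.prod μ) := by
          refine integral_congr_ae ?_
          filter_upwards [hη] with p hp
          rw [hp, Real.norm_of_nonneg (hk0 p)]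
      _ = 1 := by
          rw [hk, integral_indicator_const _ hEm, smul_eq_mul, mul_inv_cancel₀ hEpos.ne']
  · have hfx := ae_eq_sum_repr b ⟨f, hf⟩
    filter_upwards [hη, Measure.quasiMeasurePreserving_fst.ae hfx,
      Measure.quasiMeasurePreserving_snd.ae hfx] with p h₁ h₂ h₃ hne
    have hpE : p ∈ E := by
      by_contra hp
      exact hne (by rw [h₁, hk, Set.indicator_of_notMem hp])
    -- The coordinates of `f` are conjugated so that `f x = ⟪v, φ x⟫`; Cauchy-Schwarz then bounds
    -- the variation of `f` on `E`.
    set v : EuclideanSpace ℂ (Fin (Module.finrank ℂ V)) :=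
      WithLp.toLp 2 fun j => conj ⟪b j, (⟨f, hf⟩ : V)⟫_ℂ with hv
    have hnorm : ‖v‖ = ‖f‖ := by
      rw [EuclideanSpace.norm_eq]
      simp only [hv, RCLike.norm_conj]
      rw [b.sum_sq_norm_inner_right, Real.sqrt_sq (norm_nonneg _)]
      rfl
    have hinner : f p.1 - f p.2 = ⟪v, φ p.1 - φ p.2⟫_ℂ := by
      rw [h₂, h₃, ← Finset.sum_sub_distrib, PiLp.inner_apply]
      refine Finset.sum_congr rfl fun j _ => ?_
      simp only [hv, hφ, RCLike.inner_apply, PiLp.sub_apply, RCLike.conj_conj]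
      ring
    rw [hinner]
    refine (norm_inner_le_norm _ _).trans ?_
    rw [hnorm, ← dist_eq_norm]
    gcongr
    exact (show dist (φ p.1) (φ p.2) < ε from hpE).le

end CompactToKernels

/-! ### Uniform marginals and concentration on the diagonal -/

section Concentration

variable {X : Type*} [MeasurableSpace X] {μ : Measure X} [IsProbabilityMeasure μ]

theorem ae_lintegral_enorm_eq_one {η : X × X → ℝ} (hη : Integrable η (μ.prod μ))
    (h0 : ∀ᵐ p ∂(μ.prod μ), 0 ≤ η p) (hm : ∀ᵐ x ∂μ, ∫ y, η (x, y) ∂μ = 1) :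
    ∀ᵐ x ∂μ, ∫⁻ y, ‖η (x, y)‖ₑ ∂μ = 1 := by
  filter_upwards [hm, hη.prod_right_ae, Measure.ae_ae_of_ae_prod h0] with x hx hi hx0
  rw [← ofReal_integral_norm_eq_lintegral_enorm hi, ← ENNReal.ofReal_one, ← hx]
  congr 1
  refine integral_congr_ae ?_
  filter_upwards [hx0] with y hy
  exact Real.norm_of_nonneg hy

/-- Tonelli and the uniform marginal; this lets an `L²` approximation error be measured against `η`.
-/
theorem lintegral_fst_mul_enorm_of_marginal {η : X × X → ℝ} (hη : Integrable η (μ.prod μ))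
    (h0 : ∀ᵐ p ∂(μ.prod μ), 0 ≤ η p) (hm : ∀ᵐ x ∂μ, ∫ y, η (x, y) ∂μ = 1) {w : X → ℝ≥0∞}
    (hw : AEMeasurable w μ) :
    ∫⁻ p, w p.1 * ‖η p‖ₑ ∂(μ.prod μ) = ∫⁻ x, w x ∂μ := by
  have hm' : AEMeasurable (fun p : X × X => w p.1 * ‖η p‖ₑ) (μ.prod μ) :=
    hw.comp_fst.mul hη.aestronglyMeasurable.enorm
  rw [lintegral_prod _ hm']
  refine lintegral_congr_ae ?_
  filter_upwards [ae_lintegral_enorm_eq_one hη h0 hm, hη.prod_right_ae] with x hx hi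
  rw [lintegral_const_mul'' _ hi.aestronglyMeasurable.enorm, hx, mul_one]

theorem lintegral_snd_mul_enorm_of_marginal {η : X × X → ℝ} (hη : Integrable η (μ.prod μ))
    (h0 : ∀ᵐ p ∂(μ.prod μ), 0 ≤ η p) (hm : ∀ᵐ y ∂μ, ∫ x, η (x, y) ∂μ = 1) {w : X → ℝ≥0∞}
    (hw : AEMeasurable w μ) :
    ∫⁻ p, w p.2 * ‖η p‖ₑ ∂(μ.prod μ) = ∫⁻ y, w y ∂μ := by
  rw [← lintegral_fst_mul_enorm_of_marginal (η := η ∘ Prod.swap) hη.swap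
    (Measure.measurePreserving_swap.quasiMeasurePreserving.ae h0) hm hw,
    ← lintegral_prod_swap]
  rfl

omit [IsProbabilityMeasure μ] in
theorem lintegral_enorm_sq_eq (g : Lp ℂ 2 μ) :
    ∫⁻ x, ENNReal.ofReal (‖g x‖ ^ 2) ∂μ = ENNReal.ofReal (‖g‖ ^ 2) := by
  have hN : ‖g‖ ^ 2 = ∫ x, ‖g x‖ ^ 2 ∂μ := by
    have h := L2.inner_def (𝕜 := ℂ) g g
    have h' : ∀ x, ⟪g x, g x⟫_ℂ = ((‖g x‖ ^ 2 : ℝ) : ℂ) := fun x => by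
      rw [inner_self_eq_norm_sq_to_K]; simp
    simp_rw [h'] at h
    rw [integral_complex_ofReal, inner_self_eq_norm_sq_to_K] at h
    refine Complex.ofReal_injective ?_
    rw [← h]
    simp
  rw [hN, ofReal_integral_eq_lintegral_ofReal
    ((Lp.memLp g).integrable_norm_pow two_ne_zero) (ae_of_all _ fun x => by positivity)]

/-- A density with uniform marginals along which a function `f` close to `1_A` varies little gives
little mass to the pairs separated by `A`. -/
theorem eLpNorm_indicator_prod_compl_le {η : Lp ℝ 1 (μ.prod μ)} (h0 : 0 ≤ η) (h1 : ‖η‖ = 1)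
    (hfst : ∀ᵐ x ∂μ, ∫ y, η (x, y) ∂μ = 1) (hsnd : ∀ᵐ y ∂μ, ∫ x, η (x, y) ∂μ = 1)
    {f : Lp ℂ 2 μ} {τ : ℝ}
    (hf : ∀ᵐ p ∂(μ.prod μ), η p ≠ 0 → ‖f p.1 - f p.2‖ ≤ τ) {A : Set X} (hA : MeasurableSet A) :
    eLpNorm ((A ×ˢ Aᶜ).indicator η) 1 (μ.prod μ) ≤
      ENNReal.ofReal (3 * (2 * ‖f - indicatorConstLp 2 hA (measure_ne_top μ A) 1‖ ^ 2
        + τ ^ 2)) := by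
  have hη : Integrable η (μ.prod μ) := L1.integrable_coeFn η
  have h0' : ∀ᵐ p ∂(μ.prod μ), 0 ≤ η p := (Lp.coeFn_nonneg η).2 h0
  set χ : Lp ℂ 2 μ := indicatorConstLp 2 hA (measure_ne_top μ A) 1
  set g := f - χ with hg
  have hgx : ∀ᵐ x ∂μ, f x = g x + A.indicator (fun _ => (1 : ℂ)) x := by
    filter_upwards [Lp.coeFn_sub f χ, indicatorConstLp_coeFn (p := 2) (hs := hA)
      (hμs := measure_ne_top μ A) (c := (1 : ℂ))] with x h₁ h₂
    rw [hg, h₁, Pi.sub_apply, h₂, sub_add_cancel]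
  set w : X → ℝ≥0∞ := fun x => ENNReal.ofReal (‖g x‖ ^ 2) with hw
  have hwm : AEMeasurable w μ :=
    ((Lp.aestronglyMeasurable g).norm.aemeasurable.pow_const 2).ennreal_ofReal
  have hmass : ∫⁻ p, ‖η p‖ₑ ∂(μ.prod μ) = 1 := by
    rw [← ofReal_integral_norm_eq_lintegral_enorm hη, ← L1.norm_eq_integral_norm, h1,
      ENNReal.ofReal_one]
  have hηe : AEMeasurable (fun p => ‖η p‖ₑ) (μ.prod μ) := hη.aestronglyMeasurable.enorm
  have hm₁ : AEMeasurable (fun p : X × X => w p.1 * ‖η p‖ₑ) (μ.prod μ) := hwm.comp_fst.mul hηe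
  have hm₂ : AEMeasurable (fun p : X × X => w p.1 * ‖η p‖ₑ + w p.2 * ‖η p‖ₑ) (μ.prod μ) :=
    hm₁.add (hwm.comp_snd.mul hηe)
  rw [eLpNorm_one_eq_lintegral_enorm]
  calc ∫⁻ p, ‖(A ×ˢ Aᶜ).indicator η p‖ₑ ∂(μ.prod μ)
      ≤ ∫⁻ p, 3 * (w p.1 * ‖η p‖ₑ + w p.2 * ‖η p‖ₑ + ENNReal.ofReal (τ ^ 2) * ‖η p‖ₑ)
          ∂(μ.prod μ) := by
        refine lintegral_mono_ae ?_
        filter_upwards [hf, Measure.quasiMeasurePreserving_fst.ae hgx,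
          Measure.quasiMeasurePreserving_snd.ae hgx] with p hp h₁ h₂
        by_cases hpA : p ∈ A ×ˢ Aᶜ
        swap
        · simp [Set.indicator_of_notMem hpA]
        rw [Set.indicator_of_mem hpA]
        by_cases hne : η p = 0
        · simp [hne]
        rw [Set.indicator_of_mem hpA.1] at h₁
        rw [Set.indicator_of_notMem hpA.2, add_zero] at h₂
        -- Across `A ×ˢ Aᶜ` the indicator jumps by `1`; the `3` comes from `(a + b + c)² ≤ 3 (a² +
        -- b² + c²)`.
        have hle : (1 : ℝ) ≤ 3 * (‖g p.1‖ ^ 2 + ‖g p.2‖ ^ 2 + τ ^ 2) := by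
          have hone : (1 : ℂ) = (f p.1 - f p.2) - g p.1 + g p.2 := by
            rw [h₁, h₂]; ring
          have htri : (1 : ℝ) ≤ τ + ‖g p.1‖ + ‖g p.2‖ := by
            calc (1 : ℝ) = ‖(1 : ℂ)‖ := norm_one.symm
              _ = ‖(f p.1 - f p.2) - g p.1 + g p.2‖ := by rw [← hone]
              _ ≤ ‖f p.1 - f p.2‖ + ‖g p.1‖ + ‖g p.2‖ :=
                (norm_add_le _ _).trans (by gcongr; exact norm_sub_le _ _)
              _ ≤ _ := by gcongr; exact hp hne
          nlinarith [sq_nonneg (τ - ‖g p.1‖), sq_nonneg (τ - ‖g p.2‖),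
            sq_nonneg (‖g p.1‖ - ‖g p.2‖), norm_nonneg (g p.1), norm_nonneg (g p.2)]
        calc ‖η p‖ₑ = ENNReal.ofReal 1 * ‖η p‖ₑ := by rw [ENNReal.ofReal_one, one_mul]
          _ ≤ ENNReal.ofReal (3 * (‖g p.1‖ ^ 2 + ‖g p.2‖ ^ 2 + τ ^ 2)) * ‖η p‖ₑ := by gcongr
          _ = _ := by
            rw [ENNReal.ofReal_mul (by norm_num), ENNReal.ofReal_add (by positivity)
              (by positivity), ENNReal.ofReal_add (by positivity) (by positivity),
              ENNReal.ofReal_ofNat]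
            ring
    _ = 3 * (ENNReal.ofReal (‖g‖ ^ 2) + ENNReal.ofReal (‖g‖ ^ 2) + ENNReal.ofReal (τ ^ 2)) := by
        rw [lintegral_const_mul' _ _ ENNReal.ofNat_ne_top,
          lintegral_add_left' hm₂, lintegral_add_left' hm₁,
          lintegral_fst_mul_enorm_of_marginal hη h0' hfst hwm,
          lintegral_snd_mul_enorm_of_marginal hη h0' hsnd hwm,
          lintegral_const_mul' _ _ ENNReal.ofReal_ne_top, hmass, mul_one, hw,
          lintegral_enorm_sq_eq]
    _ = _ := by
        rw [ENNReal.ofReal_mul (by norm_num), two_mul, ENNReal.ofReal_add (by positivity)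
          (by positivity), ENNReal.ofReal_add (by positivity) (by positivity),
          ENNReal.ofReal_ofNat]

end Concentration

/-! ### Approximating sequences for compact actions -/

section CompactAction

variable {Γ X : Type*} [Group Γ] [MeasurableSpace X] [MulAction Γ X] [MeasurableConstSMul Γ X]
  {μ : Measure X}

/-- For a compact action on a separable space, there is a sequence of finite dimensional
subrepresentations whose lower limit is dense. -/
theorem IsCompactAction.exists_seq [SMulInvariantMeasure Γ X μ] [IsSeparable μ]
    (h : IsCompactAction Γ μ) :
    ∃ V : ℕ → Submodule ℂ (Lp ℂ 2 μ), (∀ n, IsFiniteDimInvariant (koopmanRep Γ μ) (V n)) ∧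
      ∀ f : Lp ℂ 2 μ, ∀ ε : ℝ, 0 < ε → ∃ u, ‖u - f‖ < ε ∧ ∀ᶠ n in atTop, u ∈ V n := by
  obtain ⟨S, hS, hsum⟩ := h
  have hfin : ∀ W : S, FiniteDimensional ℂ (W : Submodule ℂ (Lp ℂ 2 μ)) := fun W => (hS W W.2).1
  have hcomp : ∀ W : S, CompleteSpace (W : Submodule ℂ (Lp ℂ 2 μ)) := fun W =>
    FiniteDimensional.complete ℂ _
  set C : Submodule ℂ (Lp ℂ 2 μ) := ⨆ W : S, (W : Submodule ℂ (Lp ℂ 2 μ)) with hC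
  have hCtop : C.topologicalClosure = ⊤ := by
    have h := hsum.OrthogonalFamily.range_linearIsometry
    rw [LinearMap.range_eq_top.2 hsum.surjective_isometry] at h
    rw [hC, h]
    simp
  have hCmem : ∀ u ∈ C, ∃ W, IsFiniteDimInvariant (koopmanRep Γ μ) W ∧ u ∈ W := by
    intro u hu
    refine Submodule.iSup_induction _
      (motive := fun u => ∃ W, IsFiniteDimInvariant (koopmanRep Γ μ) W ∧ u ∈ W) hu
      (fun W v hv => ⟨W, hS W W.2, hv⟩) ⟨⊥, isFiniteDimInvariant_bot, zero_mem _⟩ ?_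
    rintro u v ⟨W, hW, hu⟩ ⟨W', hW', hv⟩
    exact ⟨W ⊔ W', hW.sup hW', Submodule.add_mem_sup hu hv⟩
  have : Fact ((2 : ℝ≥0∞) ≠ ∞) := ⟨ENNReal.ofNat_ne_top⟩
  have : SecondCountableTopology (Lp ℂ 2 μ) := inferInstance
  have : TopologicalSpace.SeparableSpace (C : Set (Lp ℂ 2 μ)) := inferInstance
  obtain ⟨u, hu⟩ := TopologicalSpace.exists_dense_seq (C : Set (Lp ℂ 2 μ))
  choose W hW huW using fun n => hCmem (u n) (u n).2
  -- Partial joins increase, and `n + 1` puts `u k` in the `n`-th one as soon as `n ≥ k`.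
  refine ⟨fun n => (Finset.range (n + 1)).sup W, fun n => ?_, fun f ε hε => ?_⟩
  · exact Finset.sup_induction isFiniteDimInvariant_bot (fun _ h₁ _ h₂ => h₁.sup h₂)
      fun k _ => hW k
  · have hf : f ∈ closure (C : Set (Lp ℂ 2 μ)) := by
      rw [← Submodule.topologicalClosure_coe, hCtop]
      trivial
    obtain ⟨v, hv, hfv⟩ := Metric.mem_closure_iff.1 hf (ε / 2) (half_pos hε)
    obtain ⟨k, hk⟩ := hu.exists_dist_lt ⟨v, hv⟩ (half_pos hε)
    refine ⟨u k, ?_, ?_⟩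
    · rw [← dist_eq_norm, dist_comm]
      calc dist f (u k) ≤ dist f v + dist v (u k) := dist_triangle _ _ _
        _ < ε / 2 + ε / 2 := add_lt_add hfv hk
        _ = ε := add_halves ε
    · filter_upwards [eventually_ge_atTop k] with n hn
      exact Finset.le_sup (f := W) (Finset.mem_range.2 (Nat.lt_succ_of_le hn)) (huW k)

/-- Compact ergodic actions admit invariant probability densities with uniform marginals that
concentrate on the diagonal. -/
theorem IsCompactAction.exists_invariant_densities [IsProbabilityMeasure μ] [IsSeparable μ]
    [ErgodicSMul Γ X μ] (h : IsCompactAction Γ μ) :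
    ∃ η : ℕ → Lp ℝ 1 (μ.prod μ),
      (∀ n, ∀ γ : Γ, (fun p : X × X => η n (γ • p.1, γ • p.2)) =ᵐ[μ.prod μ] η n) ∧
      (∀ n, 0 ≤ η n) ∧ (∀ n, ‖η n‖ = 1) ∧
      (∀ A : Set X, MeasurableSet A →
        Tendsto (fun n => eLpNorm ((A ×ˢ Aᶜ).indicator (η n)) 1 (μ.prod μ)) atTop (𝓝 0)) ∧
      (∀ n, (∀ᵐ y ∂μ, ∫ x, η n (x, y) ∂μ = 1) ∧ (∀ᵐ x ∂μ, ∫ y, η n (x, y) ∂μ = 1)) := by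
  obtain ⟨V, hV, hdense⟩ := h.exists_seq
  choose η hinv h0 h1 hη using fun n : ℕ =>
    exists_invariant_density (hV n) (Nat.one_div_pos_of_nat (α := ℝ) (n := n))
  have hmass : ∀ n, ∫ p, η n p ∂(μ.prod μ) = 1 := fun n => by
    rw [← integral_abs_eq_one (h1 n)]
    refine integral_congr_ae ?_
    filter_upwards [(Lp.coeFn_nonneg (η n)).2 (h0 n)] with p hp
    exact (abs_of_nonneg hp).symm
  have hint : ∀ n, Integrable (η n) (μ.prod μ) := fun n => L1.integrable_coeFn (η n)
  have hsnd : ∀ n, ∀ᵐ y ∂μ, ∫ x, η n (x, y) ∂μ = 1 := fun n => by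
    simpa only [hmass] using ae_integral_fst_eq_of_invariant Γ (hint n) (hinv n)
  have hfst : ∀ n, ∀ᵐ x ∂μ, ∫ y, η n (x, y) ∂μ = 1 := fun n => by
    simpa only [hmass] using ae_integral_snd_eq_of_invariant Γ (hint n) (hinv n)
  refine ⟨η, hinv, h0, h1, fun A hA => ?_, fun n => ⟨hsnd n, hfst n⟩⟩
  refine ENNReal.tendsto_nhds_zero.2 fun e he => ?_
  obtain ⟨r, hr0, hre⟩ : ∃ r : ℝ, 0 < r ∧ ENNReal.ofReal r ≤ e := by
    obtain ⟨q, hq0, hqe⟩ := ENNReal.lt_iff_exists_nnreal_btwn.1 he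
    exact ⟨q, by simpa using hq0, by simpa using hqe.le⟩
  -- With `d < √(r / 6)` the error term `3 * (2 * d ^ 2)` stays below `r`; the variation of `u`
  -- along `η n` tends to `0`.
  obtain ⟨u, hu, huV⟩ := hdense (indicatorConstLp 2 hA (measure_ne_top μ A) 1) (√(r / 6))
    (by positivity)
  set d := ‖u - indicatorConstLp 2 hA (measure_ne_top μ A) 1‖
  have hd : 3 * (2 * d ^ 2 + (‖u‖ * 0) ^ 2) < r := by
    have : d ^ 2 < √(r / 6) ^ 2 := by gcongr
    rw [Real.sq_sqrt (by positivity)] at this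
    linarith
  have hlim : Tendsto (fun n : ℕ => 3 * (2 * d ^ 2 + (‖u‖ * (1 / ((n : ℝ) + 1))) ^ 2)) atTop
      (𝓝 (3 * (2 * d ^ 2 + (‖u‖ * 0) ^ 2))) :=
    ((((tendsto_one_div_add_atTop_nhds_zero_nat (𝕜 := ℝ)).const_mul ‖u‖).pow 2).const_add
      _).const_mul 3
  filter_upwards [huV, hlim.eventually_lt_const hd] with n hn hlt
  exact (eLpNorm_indicator_prod_compl_le (h0 n) (h1 n) (hfst n) (hsnd n)
    (hη n u hn) hA).trans ((ENNReal.ofReal_le_ofReal hlt.le).trans hre)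

end CompactAction

/-! ### The equivalence and weak compactness -/

theorem proposition6p3 {Γ X : Type*} [Group Γ] [Countable Γ] [MeasurableSpace X]
    [MulAction Γ X] [MeasurableConstSMul Γ X]
    (μ : Measure X) [IsProbabilityMeasure μ] [IsSeparable μ] [ErgodicSMul Γ X μ] :
    (IsCompactAction Γ μ ↔
      ∃ η : ℕ → Lp ℝ 1 (μ.prod μ),
        (∀ n, ∀ γ : Γ, (fun p : X × X => η n (γ • p.1, γ • p.2)) =ᵐ[μ.prod μ] η n) ∧
        (∀ n, 0 ≤ η n) ∧ (∀ n, ‖η n‖ = 1) ∧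
        (∀ A : Set X, MeasurableSet A →
          Tendsto (fun n => eLpNorm ((A ×ˢ Aᶜ).indicator (η n)) 1 (μ.prod μ)) atTop (𝓝 0))) ∧
    (IsCompactAction Γ μ → IsWeaklyCompactAction Γ μ) := by
  refine ⟨⟨fun h => ?_, ?_⟩, fun h => ?_⟩
  · obtain ⟨η, hinv, h0, h1, hlim, -⟩ := h.exists_invariant_densities
    exact ⟨η, hinv, h0, h1, hlim⟩
  · rintro ⟨η, hinv, -, h1, hlim⟩
    exact isCompactAction_of_invariant_densities η hinv h1 hlim
  · obtain ⟨η, hinv, h0, h1, hlim, hmarg⟩ := h.exists_invariant_densities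
    refine ⟨η, h0, h1, hlim, fun γ => ?_, hmarg⟩
    -- Exact invariance makes every term of the sequence zero.
    refine tendsto_const_nhds.congr fun n => ?_
    have hsub : (fun p : X × X => η n p - η n (γ • p.1, γ • p.2)) =ᵐ[μ.prod μ] 0 := by
      filter_upwards [hinv n γ] with p hp
      rw [hp, sub_self, Pi.zero_apply]
    rw [eLpNorm_congr_ae hsub, eLpNorm_zero]
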